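/- Let $d\ge 0$ be an integer and let $f_1,\dots,f_d:\{0,1,2,\dots\}\to[0,+\infty]$ be (weakly) increasing functions. Let $\mathrm{Wedge}(f_1,\dots,f_d)$ be the graph with vertex set $$\mathbb V=\{(x_1,\dots,x_d,n)\in\mathbb Z^{d+1}:\ n\ge 0,\ 0\le x_i\le f_i(n)\text{ for each }1\le i\le d\},$$ in which $u,v\in\mathbb V$ are adjacent if and only if $\|u-v\|_1=1$. This locally finite connected graph is called recurrent if simple random walk on it, started from any vertex, almost surely returns to its starting vertex. For each $1\le i\le d$ define integers $h_i(n)$, $n\ge 0$, recursively by $h_i(0)=0$ and, for $n\ge1$, $$h_i(n)=\begin{cases}h_i(n-1)+1 & \text{if } h_i(n-1)+1\le f_i(n),\\ h_i(n-1) & \text{if } h_i(n-1)+1> f_i(n).\end{cases}$$ Then $\mathrm{Wedge}(f_1,\dots,f_d)$ is recurrent if and only if $$\sum_{n=0}^{\infty}\ \prod_{i=1}^{d}\frac1{h_i(n)+1}=\infty .$$ -/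

import Mathlib

open MeasureTheory ProbabilityTheory
open scoped ENNReal

noncomputable section

namespace SimpleGraph

variable {V : Type*}

/-- One step of simple random walk on a locally finite graph: a uniformly chosen neighbour of the
current vertex. (At an isolated vertex, which has no neighbour, the walk stays put; the wedges
below have no isolated vertices, see `wedge_neighborFinset_nonempty`.) -/
def walkStep (G : SimpleGraph V) [G.LocallyFinite] (v : V) : PMF V :=
  open scoped Classical in
  if h : (G.neighborFinset v).Nonempty then PMF.uniformOfFinset (G.neighborFinset v) h
  else PMF.pure v

/-- The transition kernels of simple random walk, as functions of the history up to time `n`; the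
next position depends on the position at time `n` only. -/
def walkKernel (G : SimpleGraph V) [G.LocallyFinite] [MeasurableSpace V]
    [DiscreteMeasurableSpace V] (n : ℕ) : Kernel ((i : Finset.Iic n) → V) V where
  toFun := fun x => (G.walkStep (x ⟨n, Finset.mem_Iic.2 le_rfl⟩)).toMeasure
  measurable' :=
    (Measurable.of_discrete (f := fun v : V => (G.walkStep v).toMeasure)).comp
      (measurable_pi_apply _)

instance (G : SimpleGraph V) [G.LocallyFinite] [MeasurableSpace V]
    [DiscreteMeasurableSpace V] (n : ℕ) : IsMarkovKernel (G.walkKernel n) :=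
  ⟨fun x => inferInstanceAs
    (IsProbabilityMeasure (G.walkStep (x ⟨n, Finset.mem_Iic.2 le_rfl⟩)).toMeasure)⟩

/-- The law, on the space of infinite sequences of vertices, of simple random walk started
at `v`. -/
def walkLaw (G : SimpleGraph V) [G.LocallyFinite] [MeasurableSpace V]
    [DiscreteMeasurableSpace V] (v : V) : Measure (ℕ → V) :=
  Kernel.traj (X := fun _ => V) G.walkKernel 0 (fun _ => v)

/-- A locally finite graph is recurrent if simple random walk started at any vertex almost surely
returns to that vertex. -/
def IsRecurrent (G : SimpleGraph V) [G.LocallyFinite] [MeasurableSpace V]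
    [DiscreteMeasurableSpace V] : Prop :=
  ∀ v : V, ∀ᵐ ω ∂(G.walkLaw v), ∃ n : ℕ, 1 ≤ n ∧ ω n = v

end SimpleGraph

/-- The vertex set of the wedge: points `(x₁, …, x_d, n)` of `ℤ^(d+1)` with `n ≥ 0` and
`0 ≤ xᵢ ≤ fᵢ(n)`. The last coordinate of `x` is `x (Fin.last d)`, the others are
`x i.castSucc`; the profiles take values in `[0, ∞]`. -/
def wedgeVertices {d : ℕ} (f : Fin d → ℕ → ℝ≥0∞) : Set (Fin (d + 1) → ℤ) :=
  {x | ∃ n : ℕ, x (Fin.last d) = n ∧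
    ∀ i : Fin d, ∃ k : ℕ, x i.castSucc = k ∧ (k : ℝ≥0∞) ≤ f i n}

/-- The wedge: two of its vertices are adjacent iff their `ℓ¹` distance is `1`. -/
def wedge {d : ℕ} (f : Fin d → ℕ → ℝ≥0∞) : SimpleGraph (wedgeVertices f) where
  Adj u v := ∑ j, |u.1 j - v.1 j| = 1
  symm := ⟨fun u v h => by simpa only [abs_sub_comm] using h⟩
  loopless := ⟨fun u h => by simp at h⟩

theorem wedge_neighborSet_finite {d : ℕ} (f : Fin d → ℕ → ℝ≥0∞) (u : wedgeVertices f) :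
    ((wedge f).neighborSet u).Finite := by
  refine Set.Finite.of_finite_image
    ((Set.finite_Icc (u.1 - 1) (u.1 + 1)).subset ?_) Subtype.val_injective.injOn
  rintro _ ⟨v, hv, rfl⟩
  have hv' : ∑ j, |u.1 j - v.1 j| = 1 := hv
  have key : ∀ j, |u.1 j - v.1 j| ≤ 1 := fun j => hv' ▸
    Finset.single_le_sum (f := fun j => |u.1 j - v.1 j|) (fun _ _ => abs_nonneg _)
      (Finset.mem_univ j)
  refine ⟨fun j => ?_, fun j => ?_⟩ <;>
  · have := abs_le.1 (key j)
    simp only [Pi.sub_apply, Pi.add_apply, Pi.one_apply]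
    omega

instance {d : ℕ} (f : Fin d → ℕ → ℝ≥0∞) : (wedge f).LocallyFinite :=
  fun u => (wedge_neighborSet_finite f u).fintype

/-- In a wedge with increasing profiles every vertex has a neighbour: the one above it. -/
theorem wedge_neighborFinset_nonempty {d : ℕ} {f : Fin d → ℕ → ℝ≥0∞} (hf : ∀ i, Monotone (f i))
    (u : wedgeVertices f) : ((wedge f).neighborFinset u).Nonempty := by
  obtain ⟨x, n, hn, hx⟩ := u
  refine ⟨⟨x + Pi.single (Fin.last d) 1, n + 1, by simp [hn], fun i => ?_⟩, ?_⟩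
  · obtain ⟨k, hk, hle⟩ := hx i
    exact ⟨k, by simp [hk, (Fin.castSucc_lt_last i).ne], hle.trans (hf i n.le_succ)⟩
  · rw [SimpleGraph.mem_neighborFinset]
    change ∑ j, |x j - (x + Pi.single (Fin.last d) 1 : Fin (d + 1) → ℤ) j| = 1
    simp [Pi.single_apply, apply_ite abs]

/-- The greedy integer profile below `f`: it starts at `0` and increases by `1` at each step at
which the increased value does not exceed `f`, and otherwise stays constant. -/
def greedyProfile (f : ℕ → ℝ≥0∞) : ℕ → ℕ
  | 0 => 0
  | n + 1 =>
    if (greedyProfile f n : ℝ≥0∞) + 1 ≤ f (n + 1) then greedyProfile f n + 1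
    else greedyProfile f n

end

/-! Return probabilities are turned into electrical energy, and one exhaustion by boxes serves both
directions. Let `B_n` be the box of height `n` with sides `hᵢ(n)`, and let `P_n = ∏ᵢ (hᵢ(n) + 1)`,
the number of points in its top slice.

The walk returns to `o` almost surely exactly when finitely supported functions equal to `1` at `o`
have arbitrarily small Dirichlet energy. One half tests with the truncated hitting probability
(`exists_energy_le_of_tendsto_avoidProb`). The other bounds the escape probability by the energy
through Picone's inequality (`exists_tendsto_avoidProb_le`); it needs neither connectedness nor a
variational principle.

Divergence: at most `(d + 1) P_n` edges leave `B_n`. Those through the top are counted by the slice.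
An edge through side `i` starts within `hᵢ(n)` of the top, since otherwise the greedy profile would
already have grown further; so each side costs no more than the top. All these edges end in
`B_(n+1)`, and Nash-Williams applies (`isRecurrent_of_tendsto_sum_inv`).

Convergence: let `A_n` be the mean of a finitely supported `F` over the slice of `B_n` at height
`n`. Since each `hᵢ` grows by at most one per level, `|A_n - A_(n+1)|² ≤ (d + 1)² Q_(n+1) / P_n`,
with `Q_n` the energy near slice `n`. Telescoping from `A_0 = F(0)` to `0` and Cauchy-Schwarz bound
`F(0)²` by `∑ 1 / P_n` times the energy (`sq_wedgePoint_zero_le`), so the energy cannot be small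
when `F(0) = 1`. -/

namespace SimpleGraph

variable {V : Type*}

/-- The mean of `φ` over the neighbours of `v`. -/
noncomputable def neighborMean (G : SimpleGraph V) [G.LocallyFinite] (φ : V → ℝ) (v : V) : ℝ :=
  (∑ y ∈ G.neighborFinset v, φ y) / (G.neighborFinset v).card

open scoped Classical in
/-- The probability that simple random walk from `v` avoids `o` at the times `1, …, n`. -/
noncomputable def avoidProb (G : SimpleGraph V) [G.LocallyFinite] (o : V) : ℕ → V → ℝ
  | 0, _ => 1
  | n + 1, v => G.neighborMean (fun y => if y = o then 0 else avoidProb G o n y) v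

open scoped Classical in
/-- The probability that simple random walk from `v` visits `o` by time `n`. -/
noncomputable def hitProb (G : SimpleGraph V) [G.LocallyFinite] (o : V) (n : ℕ) (v : V) : ℝ :=
  1 - if v = o then 0 else G.avoidProb o n v

/-! ### Averaging over neighbours and avoidance probabilities -/

section Walk

variable (G : SimpleGraph V) [G.LocallyFinite]

theorem neighborMean_nonneg {φ : V → ℝ} (h : ∀ y, 0 ≤ φ y) (v : V) : 0 ≤ G.neighborMean φ v :=
  div_nonneg (Finset.sum_nonneg fun y _ => h y) (Nat.cast_nonneg _)

theorem neighborMean_mono {φ ψ : V → ℝ} (h : ∀ y, φ y ≤ ψ y) (v : V) :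
    G.neighborMean φ v ≤ G.neighborMean ψ v :=
  div_le_div_of_nonneg_right (Finset.sum_le_sum fun y _ => h y) (Nat.cast_nonneg _)

theorem neighborMean_one_sub {v : V} (hv : (G.neighborFinset v).Nonempty) (φ : V → ℝ) :
    G.neighborMean (fun y => 1 - φ y) v = 1 - G.neighborMean φ v := by
  have : ((G.neighborFinset v).card : ℝ) ≠ 0 := by exact_mod_cast hv.card_pos.ne'
  simp only [neighborMean, Finset.sum_sub_distrib, Finset.sum_const, nsmul_eq_mul, mul_one]
  field_simp

theorem sum_neighborFinset_sub (φ : V → ℝ) {v : V} (hv : (G.neighborFinset v).Nonempty) :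
    ∑ y ∈ G.neighborFinset v, (φ v - φ y) =
      (G.neighborFinset v).card * (φ v - G.neighborMean φ v) := by
  have : ((G.neighborFinset v).card : ℝ) ≠ 0 := by exact_mod_cast hv.card_pos.ne'
  simp only [neighborMean, Finset.sum_sub_distrib, Finset.sum_const, nsmul_eq_mul]
  field_simp

theorem avoidProb_nonneg (o : V) (n : ℕ) (v : V) : 0 ≤ G.avoidProb o n v := by
  induction n generalizing v with
  | zero => simp [avoidProb]
  | succ n ih =>
    refine G.neighborMean_nonneg (fun y => ?_) v
    split_ifs
    exacts [le_rfl, ih y]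


theorem avoidProb_succ_le (hG : ∀ v, (G.neighborFinset v).Nonempty) (o : V) (n : ℕ) (v : V) :
    G.avoidProb o (n + 1) v ≤ G.avoidProb o n v := by
  induction n generalizing v with
  | zero =>
    refine (G.neighborMean_mono (ψ := fun _ => 1) (fun y => ?_) v).trans_eq ?_
    · split_ifs <;> simp [avoidProb]
    · have := G.neighborMean_one_sub (hG v) (fun _ => 0)
      simpa [neighborMean, avoidProb] using this
  | succ n ih =>
    refine G.neighborMean_mono (fun y => ?_) v
    split_ifs
    exacts [le_rfl, ih y]

end Walk
-- From the law of the walk to the avoidance recursion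
section Law
variable (G : SimpleGraph V) [G.LocallyFinite] [MeasurableSpace V] [DiscreteMeasurableSpace V]

theorem lintegral_walkStep [Countable V] {φ : V → ℝ} (hφ : ∀ y, 0 ≤ φ y) {v : V}
    (hv : (G.neighborFinset v).Nonempty) :
    ∫⁻ y, ENNReal.ofReal (φ y) ∂(G.walkStep v).toMeasure =
      ENNReal.ofReal (G.neighborMean φ v) := by
  classical
  have hc : (0 : ℝ) < (G.neighborFinset v).card := by exact_mod_cast hv.card_pos
  rw [lintegral_countable', tsum_eq_sum (s := G.neighborFinset v), neighborMean,
    ENNReal.ofReal_div_of_pos hc, ENNReal.ofReal_sum_of_nonneg fun y _ => hφ y,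
    div_eq_mul_inv, Finset.sum_mul]
  · refine Finset.sum_congr rfl fun y hy => ?_
    rw [PMF.toMeasure_apply_singleton _ _ (measurableSet_singleton _), walkStep, dif_pos hv,
      PMF.uniformOfFinset_apply_of_mem hv hy, ENNReal.ofReal_natCast]
  · intro y hy
    rw [PMF.toMeasure_apply_singleton _ _ (measurableSet_singleton _), walkStep, dif_pos hv,
      PMF.uniformOfFinset_apply_of_notMem hv hy, mul_zero]

/-- The one-step Markov property: `g` is an arbitrary weight depending on the path up to time `n`.
-/
theorem lintegral_walkLaw_succ (v : V) (n : ℕ) {g : ((i : Finset.Iic n) → V) → ℝ≥0∞}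
    (hg : Measurable g) (φ : V → ℝ≥0∞) :
    ∫⁻ ω, g (Preorder.frestrictLe n ω) * φ (ω (n + 1)) ∂(G.walkLaw v) =
      ∫⁻ ω, g (Preorder.frestrictLe n ω) * ∫⁻ y, φ y ∂(G.walkStep (ω n)).toMeasure
        ∂(G.walkLaw v) := by
  have hφ : Measurable φ := .of_discrete
  have h1 := Kernel.partialTraj_compProd_eq_map_traj (X := fun _ => V) (κ := G.walkKernel)
    (Nat.zero_le n) (x₀ := fun _ => v)
  have h2 := Kernel.traj_map_frestrictLe_apply (X := fun _ => V) (κ := G.walkKernel)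
    0 n (fun _ => v)
  have hm : Measurable fun p : ((i : Finset.Iic n) → V) × V => g p.1 * φ p.2 :=
    (hg.comp measurable_fst).mul (hφ.comp measurable_snd)
  have h3 := congrArg (fun μ => ∫⁻ p, g p.1 * φ p.2 ∂μ) h1
  beta_reduce at h3
  rw [lintegral_map hm (by fun_prop), Measure.lintegral_compProd hm] at h3
  rw [walkLaw, ← h3, ← h2, lintegral_map]
  · refine lintegral_congr fun ω => ?_
    exact lintegral_const_mul (g (Preorder.frestrictLe n ω)) hφ
  · exact hm.lintegral_kernel_prod_right'
  · fun_prop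

theorem walkLaw_avoid [Countable V] (hG : ∀ v, (G.neighborFinset v).Nonempty) (o v : V) (n : ℕ) :
    G.walkLaw v {ω | ∀ k, 1 ≤ k → k ≤ n → ω k ≠ o} = ENNReal.ofReal (G.avoidProb o n v) := by
  classical
  have meas : ∀ n, MeasurableSet {x : (i : Finset.Iic n) → V | ∀ i, 1 ≤ i.1 → x i ≠ o} := by
    intro n
    simp only [Set.ofPred_forall]
    refine .iInter fun i => .iInter fun _ => ?_
    exact (measurableSet_singleton o).compl.preimage (measurable_pi_apply i)
  have hpre : ∀ n, {ω : ℕ → V | ∀ k, 1 ≤ k → k ≤ n → ω k ≠ o} =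
      Preorder.frestrictLe (π := fun _ => V) n ⁻¹' {x | ∀ i, 1 ≤ i.1 → x i ≠ o} := by
    intro n
    ext ω
    simp only [Set.mem_ofPred_eq, Set.mem_preimage, Subtype.forall, Finset.mem_Iic,
      Preorder.frestrictLe_apply]
    exact forall_congr' fun k => forall_comm
  have meas' : ∀ n, MeasurableSet {ω : ℕ → V | ∀ k, 1 ≤ k → k ≤ n → ω k ≠ o} := by
    intro n
    rw [hpre]
    exact (meas n).preimage (by fun_prop)
  -- Splitting the avoidance time as `n + m` lets the induction move one step at a time from the
  -- path to the recursion; `m = 0` gives the claim.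
  have key : ∀ n m, ∫⁻ ω in {ω : ℕ → V | ∀ k, 1 ≤ k → k ≤ n → ω k ≠ o},
      ENNReal.ofReal (G.avoidProb o m (ω n)) ∂(G.walkLaw v) =
        ∫⁻ ω, ENNReal.ofReal (G.avoidProb o (n + m) (ω 0)) ∂(G.walkLaw v) := by
    intro n
    induction n with
    | zero =>
      intro m
      have : {ω : ℕ → V | ∀ k, 1 ≤ k → k ≤ 0 → ω k ≠ o} = Set.univ := by
        ext ω; simp only [Set.mem_ofPred_eq, Set.mem_univ, iff_true]; omega
      rw [this, Measure.restrict_univ, zero_add]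
    | succ n ih =>
      intro m
      rw [show n + 1 + m = n + (m + 1) by omega, ← ih (m + 1), ← lintegral_indicator (meas' _),
        ← lintegral_indicator (meas' _)]
      have := G.lintegral_walkLaw_succ v n
        (g := Set.indicator {x | ∀ i, 1 ≤ i.1 → x i ≠ o} 1)
        (measurable_one.indicator (meas n))
        (fun y => ENNReal.ofReal (if y = o then 0 else G.avoidProb o m y))
      have hnn : ∀ y, 0 ≤ if y = o then 0 else G.avoidProb o m y := fun y => by
        split_ifs
        exacts [le_rfl, G.avoidProb_nonneg o m y]
      simp_rw [G.lintegral_walkStep hnn (hG _)] at this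
      convert this using 3 with ω ω
      · simp only [Set.indicator_apply]
        by_cases h : ω (n + 1) = o
        · rw [if_neg, if_pos h]
          · simp
          · exact fun h' => h' (n + 1) (by omega) le_rfl h
        · have : ω ∈ {ω : ℕ → V | ∀ k, 1 ≤ k → k ≤ n + 1 → ω k ≠ o} ↔
              ω ∈ {ω : ℕ → V | ∀ k, 1 ≤ k → k ≤ n → ω k ≠ o} := by
            refine ⟨fun h' k h1 h2 => h' k h1 (by omega), fun h' k h1 h2 => ?_⟩
            rcases h2.lt_or_eq with h2 | rfl
            exacts [h' k h1 (by omega), h]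
          rw [hpre n, Set.mem_preimage] at this
          simp [this, h]
      · simp only [Set.indicator_apply, hpre n, Set.mem_preimage]
        split_ifs <;> simp [avoidProb]
  have h0 : ∀ᵐ ω ∂(G.walkLaw v), ω 0 = v := by
    have h2 := Kernel.traj_map_frestrictLe_apply (X := fun _ => V) (κ := G.walkKernel)
      0 0 (fun _ => v)
    rw [Kernel.partialTraj_self, Kernel.id_apply] at h2
    have h3 : ∀ᵐ x ∂(Measure.dirac (fun _ : Finset.Iic 0 => v)), x ⟨0, by simp⟩ = v := by
      rw [ae_dirac_iff]
      exact (measurableSet_singleton v).preimage (measurable_pi_apply _)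
    rw [← h2] at h3
    exact ae_of_ae_map (by fun_prop) h3
  have hp : IsProbabilityMeasure (G.walkLaw v) := by unfold walkLaw; infer_instance
  have := key n 0
  simp only [avoidProb, ENNReal.ofReal_one, lintegral_one, Measure.restrict_apply_univ,
    add_zero] at this
  rw [this, lintegral_congr_ae (g := fun _ => ENNReal.ofReal (G.avoidProb o n v))]
  · simp
  · filter_upwards [h0] with ω hω
    rw [hω]

open Filter Topology in
theorem ae_return_iff [Countable V] (hG : ∀ v, (G.neighborFinset v).Nonempty) (o : V) :
    (∀ᵐ ω ∂(G.walkLaw o), ∃ n : ℕ, 1 ≤ n ∧ ω n = o) ↔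
      Tendsto (fun n => G.avoidProb o n o) atTop (𝓝 0) := by
  have hp : IsProbabilityMeasure (G.walkLaw o) := by unfold walkLaw; infer_instance
  have hm : ∀ n, MeasurableSet {ω : ℕ → V | ∀ k, 1 ≤ k → k ≤ n → ω k ≠ o} := by
    intro n
    simp only [Set.ofPred_forall]
    refine .iInter fun i => .iInter fun _ => .iInter fun _ => ?_
    exact (measurableSet_singleton o).compl.preimage (measurable_pi_apply i)
  have h1 : Tendsto (fun n => G.walkLaw o {ω | ∀ k, 1 ≤ k → k ≤ n → ω k ≠ o}) atTop
      (𝓝 (G.walkLaw o (⋂ n, {ω | ∀ k, 1 ≤ k → k ≤ n → ω k ≠ o}))) :=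
    tendsto_measure_iInter_atTop (fun n => (hm n).nullMeasurableSet)
      (fun m n hmn ω hω k h1 h2 => hω k h1 (h2.trans hmn)) ⟨0, measure_ne_top _ _⟩
  have h2 : (⋂ n, {ω : ℕ → V | ∀ k, 1 ≤ k → k ≤ n → ω k ≠ o}) =
      {ω | ¬ ∃ n : ℕ, 1 ≤ n ∧ ω n = o} := by
    ext ω
    simp only [Set.mem_iInter, Set.mem_ofPred_eq, not_exists, not_and]
    exact ⟨fun h n hn => h n n hn le_rfl, fun h n k hk _ => h k hk⟩
  simp only [G.walkLaw_avoid hG, h2] at h1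
  rw [ae_iff]
  have h3 : Tendsto (fun n => G.avoidProb o n o) atTop (𝓝 0) ↔
      Tendsto (fun n => ENNReal.ofReal (G.avoidProb o n o)) atTop (𝓝 0) := by
    refine ⟨fun h => by simpa using ENNReal.tendsto_ofReal h, fun h => ?_⟩
    have := (ENNReal.tendsto_toReal ENNReal.zero_ne_top).comp h
    refine this.congr fun n => ?_
    simp [G.avoidProb_nonneg o n o]
  rw [h3]
  exact ⟨fun h => h ▸ h1, fun h => tendsto_nhds_unique h1 h⟩
end Law
-- Dirichlet energy on finite sets
section Energy
variable (G : SimpleGraph V)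

open scoped Classical in
/-- The Dirichlet form restricted to a finite set of vertices; each edge is counted twice. -/
noncomputable def dirichletForm (S : Finset V) (a b : V → ℝ) : ℝ :=
  ∑ x ∈ S, ∑ y ∈ S, if G.Adj x y then (a x - a y) * (b x - b y) else 0

variable {G}

/-- Picone's inequality. -/
theorem dirichletForm_sq_div_le (S : Finset V) (F : V → ℝ) {w : V → ℝ} (hw : ∀ x, 0 < w x) :
    G.dirichletForm S (fun x => F x ^ 2 / w x) w ≤ G.dirichletForm S F F := by
  refine Finset.sum_le_sum fun x _ => Finset.sum_le_sum fun y _ => ?_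
  split_ifs
  · have h1 := hw x
    have h2 := hw y
    have : (F x - F y) * (F x - F y) - (F x ^ 2 / w x - F y ^ 2 / w y) * (w x - w y) =
        (F x * w y - F y * w x) ^ 2 / (w x * w y) := by
      field_simp
      ring
    have h3 : 0 ≤ (F x * w y - F y * w x) ^ 2 / (w x * w y) := by positivity
    linarith
  · exact le_rfl

variable [G.LocallyFinite]

/-- Summation by parts. -/
theorem dirichletForm_eq {S : Finset V} {a : V → ℝ}
    (hS : ∀ x, a x ≠ 0 → x ∈ S ∧ ∀ y, G.Adj x y → y ∈ S) (b : V → ℝ) :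
    G.dirichletForm S a b = 2 * ∑ x ∈ S, a x * ∑ y ∈ G.neighborFinset x, (b x - b y) := by
  classical
  have h1 : ∀ x, a x * ∑ y ∈ G.neighborFinset x, (b x - b y) =
      ∑ y ∈ S, if G.Adj x y then a x * (b x - b y) else 0 := by
    intro x
    by_cases hx : a x = 0
    · simp [hx]
    · rw [Finset.mul_sum, ← Finset.sum_filter]
      refine Finset.sum_congr ?_ fun _ _ => rfl
      ext y
      simp only [mem_neighborFinset, Finset.mem_filter]
      exact ⟨fun h => ⟨(hS x hx).2 y h, h⟩, And.right⟩
  have h2 : ∑ x ∈ S, ∑ y ∈ S, (if G.Adj x y then a x * (b x - b y) else 0) =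
      ∑ x ∈ S, ∑ y ∈ S, if G.Adj x y then a y * (b y - b x) else 0 := by
    rw [Finset.sum_comm]
    simp only [G.adj_comm]
  simp only [h1]
  rw [two_mul]
  nth_rw 2 [h2]
  rw [← Finset.sum_add_distrib, dirichletForm]
  refine Finset.sum_congr rfl fun x _ => ?_
  rw [← Finset.sum_add_distrib]
  refine Finset.sum_congr rfl fun y _ => ?_
  split_ifs <;> ring

/-- Every edge along which `F` varies has both ends in `S`, so `S` sees the whole energy. -/
theorem sum_sum_neighborFinset_le_dirichletForm {S : Finset V} {F : V → ℝ}
    (hS : ∀ x, F x ≠ 0 → x ∈ S ∧ ∀ y, G.Adj x y → y ∈ S) (T : Finset V) :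
    ∑ x ∈ T, ∑ y ∈ G.neighborFinset x, (F x - F y) ^ 2 ≤ G.dirichletForm S F F := by
  classical
  have hF : ∀ x y, G.Adj x y → F x ≠ F y → x ∈ S ∧ y ∈ S := by
    intro x y h hne
    by_cases hx : F x = 0
    · have := hS y (fun h => hne (hx.trans h.symm))
      exact ⟨this.2 x h.symm, this.1⟩
    · exact ⟨(hS x hx).1, (hS x hx).2 y h⟩
  have h1 : ∀ x, ∑ y ∈ G.neighborFinset x, (F x - F y) ^ 2 =
      ∑ y ∈ S, if G.Adj x y then (F x - F y) * (F x - F y) else 0 := by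
    intro x
    rw [← Finset.sum_filter]
    simp only [← sq]
    refine (Finset.sum_subset_zero_on_sdiff (fun y hy => ?_) (fun y hy => ?_)
      (fun _ _ => rfl)).symm
    · simpa using (Finset.mem_filter.1 hy).2
    · simp only [Finset.mem_sdiff, mem_neighborFinset, Finset.mem_filter, not_and] at hy
      by_contra hne
      exact hy.2 (hF x y hy.1 (fun h => hne (by simp [h]))).2 hy.1
  have h2 : ∀ x, 0 ≤ ∑ y ∈ G.neighborFinset x, (F x - F y) ^ 2 :=
    fun x => Finset.sum_nonneg fun _ _ => sq_nonneg _
  calc _ ≤ ∑ x ∈ T ∪ S, ∑ y ∈ G.neighborFinset x, (F x - F y) ^ 2 :=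
        Finset.sum_le_sum_of_subset_of_nonneg Finset.subset_union_left fun x _ _ => h2 x
    _ = ∑ x ∈ S, ∑ y ∈ G.neighborFinset x, (F x - F y) ^ 2 := by
        refine (Finset.sum_subset Finset.subset_union_right fun x _ hx => ?_).symm
        refine Finset.sum_eq_zero fun y hy => ?_
        by_contra hne
        exact hx (hF x y (by simpa using hy) (fun h => hne (by simp [h]))).1
    _ = _ := Finset.sum_congr rfl fun x _ => h1 x

end Energy

/-! ### Escape probability versus energy -/

section Escape
variable (G : SimpleGraph V) [G.LocallyFinite]

theorem hitProb_self (o : V) (n : ℕ) : G.hitProb o n o = 1 := by simp [hitProb]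

theorem neighborMean_hitProb {v : V} (hv : (G.neighborFinset v).Nonempty) (o : V) (n : ℕ) :
    G.neighborMean (G.hitProb o n) v = 1 - G.avoidProb o (n + 1) v :=
  G.neighborMean_one_sub hv _

theorem avoidProb_le_one (hG : ∀ v, (G.neighborFinset v).Nonempty) (o : V) (n : ℕ) (v : V) :
    G.avoidProb o n v ≤ 1 :=
  (antitone_nat_of_succ_le (f := fun n => G.avoidProb o n v)
    fun n => G.avoidProb_succ_le hG o n v) (Nat.zero_le n)

theorem finite_hitProb_ne_zero (hG : ∀ v, (G.neighborFinset v).Nonempty) (o : V) (n : ℕ) :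
    {v | G.hitProb o n v ≠ 0}.Finite := by
  classical
  induction n with
  | zero =>
    refine (Set.finite_singleton o).subset fun v hv => ?_
    by_contra h
    exact hv (by simp [hitProb, avoidProb, show v ≠ o from h])
  | succ n ih =>
    refine ((Set.finite_singleton o).union
      (ih.biUnion fun y _ => (G.neighborFinset y).finite_toSet)).subset fun v hv => ?_
    by_contra h
    simp only [Set.mem_union, Set.mem_singleton_iff, Set.mem_iUnion, not_or, not_exists,
      Finset.mem_coe, mem_neighborFinset] at h
    refine hv ?_
    have h1 := G.neighborMean_hitProb (hG v) o n
    rw [hitProb, if_neg h.1, ← h1, neighborMean, Finset.sum_eq_zero, zero_div]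
    intro y hy
    by_contra hne
    exact h.2 y hne (by simpa using hy : G.Adj v y).symm

open Filter Topology

/-- If the walk returns to `o` almost surely, then `o` has zero capacity. -/
theorem exists_energy_le_of_tendsto_avoidProb (hG : ∀ v, (G.neighborFinset v).Nonempty) {o : V}
    (ho : Tendsto (fun n => G.avoidProb o n o) atTop (𝓝 0)) {ε : ℝ} (hε : 0 < ε) :
    ∃ F : V → ℝ, {v | F v ≠ 0}.Finite ∧ F o = 1 ∧
      ∀ T : Finset V, ∑ x ∈ T, ∑ y ∈ G.neighborFinset x, (F x - F y) ^ 2 ≤ ε := by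
  classical
  have h1 : Tendsto (fun n => 2 * ((G.neighborFinset o).card * G.avoidProb o (n + 1) o)) atTop
      (𝓝 0) := by
    simpa using ((((tendsto_add_atTop_iff_nat 1).2 ho).const_mul
      ((G.neighborFinset o).card : ℝ)).const_mul 2)
  obtain ⟨n, hn⟩ := (h1.eventually_le_const hε).exists
  have hfin := G.finite_hitProb_ne_zero hG o n
  refine ⟨G.hitProb o n, hfin, G.hitProb_self o n, fun T => ?_⟩
  set S : Finset V := hfin.toFinset ∪ hfin.toFinset.biUnion fun x => G.neighborFinset x with hS
  have hS' : ∀ x, G.hitProb o n x ≠ 0 → x ∈ S ∧ ∀ y, G.Adj x y → y ∈ S := by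
    intro x hx
    refine ⟨Finset.mem_union_left _ (by simpa using hx), fun y hy => ?_⟩
    exact Finset.mem_union_right _ (Finset.mem_biUnion.2 ⟨x, by simpa using hx, by simpa using hy⟩)
  refine (sum_sum_neighborFinset_le_dirichletForm hS' T).trans ?_
  rw [dirichletForm_eq hS']
  refine le_trans (mul_le_mul_of_nonneg_left ?_ zero_le_two) hn
  have hoS : o ∈ S := (hS' o (by simp [hitProb_self])).1
  rw [← Finset.add_sum_erase _ _ hoS,
    G.sum_neighborFinset_sub _ (hG o), hitProb_self, one_mul, G.neighborMean_hitProb (hG o),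
    sub_sub_cancel]
  -- After summation by parts only `o` contributes positively: elsewhere the hitting probability
  -- minus its neighbour mean is `avoidProb o (n + 1) x - avoidProb o n x ≤ 0`.
  refine add_le_of_nonpos_right (Finset.sum_nonpos fun x hx => ?_)
  rw [G.sum_neighborFinset_sub _ (hG x), G.neighborMean_hitProb (hG x), hitProb,
    if_neg (Finset.ne_of_mem_erase hx)]
  have h2 := G.avoidProb_succ_le hG o n x
  have h3 := G.avoidProb_le_one hG o n x
  refine mul_nonpos_of_nonneg_of_nonpos (by linarith)
    (mul_nonpos_of_nonneg_of_nonpos (Nat.cast_nonneg _) (by linarith))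

/-- The escape probability from `o` is at most the energy of any finitely supported function
which takes the value `1` at `o`. -/
theorem exists_tendsto_avoidProb_le (hG : ∀ v, (G.neighborFinset v).Nonempty) (o : V) :
    ∃ p : ℝ, Tendsto (fun n => G.avoidProb o n o) atTop (𝓝 p) ∧ 0 ≤ p ∧
      ∀ (F : V → ℝ) (S : Finset V), (∀ x, F x ≠ 0 → x ∈ S ∧ ∀ y, G.Adj x y → y ∈ S) →
        F o ^ 2 * p ≤ G.dirichletForm S F F := by
  classical
  have hlim : ∀ v, ∃ p, Tendsto (fun n => G.avoidProb o n v) atTop (𝓝 p) := fun v =>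
    ⟨_, tendsto_atTop_ciInf (antitone_nat_of_succ_le fun n => G.avoidProb_succ_le hG o n v)
      ⟨0, by rintro _ ⟨n, rfl⟩; exact G.avoidProb_nonneg o n v⟩⟩
  choose p hp using hlim
  have hp0 : ∀ v, 0 ≤ p v := fun v => ge_of_tendsto' (hp v) fun n => G.avoidProb_nonneg o n v
  have hp1 : ∀ v, p v ≤ 1 := fun v => le_of_tendsto' (hp v) fun n => G.avoidProb_le_one hG o n v
  have hmean : ∀ v, p v = G.neighborMean (fun y => if y = o then 0 else p y) v := by
    intro v
    refine tendsto_nhds_unique ((tendsto_add_atTop_iff_nat 1).2 (hp v)) ?_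
    refine Tendsto.div_const (tendsto_finsetSum _ fun y _ => ?_) _
    by_cases hy : y = o
    · simp [hy]
    · simpa [hy] using hp y
  refine ⟨p o, hp o, hp0 o, fun F S hS => ?_⟩
  -- `w` is one plus the probability of ever visiting `o`. The extra one makes it positive without
  -- connectedness. It is harmonic off `o` and exceeds its mean by `p o` at `o`, so Picone leaves
  -- only the term at `o`. The nested differences let `neighborMean_one_sub` apply repeatedly.
  set w : V → ℝ := fun v => 1 - ((if v = o then 0 else p v) - 1) with hw
  have hwpos : ∀ v, 0 < w v := by
    intro v
    have := hp1 v
    simp only [hw]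
    split_ifs <;> linarith
  refine le_trans ?_ (dirichletForm_sq_div_le S F hwpos)
  have hwm : ∀ v, G.neighborMean w v = 2 - p v := by
    intro v
    have h1 := G.neighborMean_one_sub (hG v) (fun y => (if y = o then 0 else p y) - 1)
    have h2 := G.neighborMean_one_sub (hG v) (fun y => 1 - (if y = o then 0 else p y))
    have h3 := G.neighborMean_one_sub (hG v) (fun y => (if y = o then 0 else p y))
    rw [← hmean] at h3
    simp only [sub_sub_cancel] at h1 h2 h3
    rw [hw, h1]
    have h4 : G.neighborMean (fun y => (if y = o then 0 else p y) - 1) v =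
        - G.neighborMean (fun y => 1 - (if y = o then 0 else p y)) v := by
      simp only [neighborMean, ← neg_div, ← Finset.sum_neg_distrib, neg_sub]
    rw [h4, h3]
    ring
  have hwo : w o = 2 := by
    simp only [hw, if_true]
    norm_num
  rw [dirichletForm_eq]
  · have hoo : F o ^ 2 * p o ≤ 2 * (F o ^ 2 / w o * ((G.neighborFinset o).card * p o)) := by
      have h2 : (1 : ℝ) ≤ (G.neighborFinset o).card := by exact_mod_cast (hG o).card_pos
      rw [hwo]
      have h3 : 0 ≤ F o ^ 2 * p o := mul_nonneg (sq_nonneg _) (hp0 o)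
      nlinarith
    -- If `F o = 0`, the vertex `o` need not lie in `S`, so its term cannot be split off.
    by_cases hFo : F o = 0
    · rw [hFo]
      refine le_trans (by simp) (mul_nonneg zero_le_two (Finset.sum_nonneg fun x hx => ?_))
      by_cases hx : x = o
      · simp [hx, hFo]
      · rw [G.sum_neighborFinset_sub _ (hG x), hwm]
        simp only [hw, if_neg hx]
        ring_nf
        exact le_rfl
    · refine hoo.trans (mul_le_mul_of_nonneg_left ?_ zero_le_two)
      rw [← Finset.add_sum_erase _ _ (hS o hFo).1, G.sum_neighborFinset_sub _ (hG o), hwm,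
        Finset.sum_eq_zero, add_zero]
      · rw [hwo, sub_sub_cancel]
      · intro x hx
        rw [G.sum_neighborFinset_sub _ (hG x), hwm]
        simp only [hw, if_neg (Finset.ne_of_mem_erase hx)]
        ring_nf
  · intro x hx
    refine hS x fun h => hx ?_
    simp [h]

end Escape

open Filter Topology in
/-- The Nash-Williams criterion. -/
theorem isRecurrent_of_tendsto_sum_inv (G : SimpleGraph V) [G.LocallyFinite] [MeasurableSpace V]
    [DiscreteMeasurableSpace V] [Countable V] (hG : ∀ v, (G.neighborFinset v).Nonempty)
    {r : V → ℕ} (hfin : ∀ n, {v | r v ≤ n}.Finite) (hadj : ∀ u v, G.Adj u v → r v ≤ r u + 1)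
    {c : ℕ → ℝ} (hc : ∀ n, 0 < c n)
    (hcard : ∀ n (T : Finset (V × V)),
      (∀ p ∈ T, G.Adj p.1 p.2 ∧ r p.1 = n ∧ r p.2 = n + 1) → (T.card : ℝ) ≤ c n)
    (hdiv : Tendsto (fun N => ∑ n ∈ Finset.range N, (c n)⁻¹) atTop atTop) :
    G.IsRecurrent := by
  classical
  intro o
  rw [G.ae_return_iff hG]
  obtain ⟨p, hp, hp0, hle⟩ := G.exists_tendsto_avoidProb_le hG o
  set s : ℕ → ℝ := fun N => ∑ n ∈ Finset.range N, (c n)⁻¹ with hs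
  have hbound : ∀ N, 0 < s N → (1 - s (min (r o) N) / s N) ^ 2 * p ≤ 2 / s N := by
    intro N hN
    -- The voltage obtained by treating each cut as `c n` parallel unit resistors: its drop across
    -- the cut is proportional to `(c n)⁻¹`, and it vanishes from rank `N` on.
    set Ψ : ℕ → ℝ := fun n => 1 - s (min n N) / s N with hΨ
    have hΨN : ∀ n, N ≤ n → Ψ n = 0 := fun n hn => by
      simp only [hΨ, min_eq_right hn, div_self hN.ne', sub_self]
    have hΨs : ∀ n, n < N → Ψ n - Ψ (n + 1) = (c n)⁻¹ / s N := by
      intro n hn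
      simp only [hΨ, min_eq_left hn.le, min_eq_left (Nat.succ_le_of_lt hn), hs,
        Finset.sum_range_succ]
      ring
    set S := (hfin N).toFinset with hS
    have hmem : ∀ v, v ∈ S ↔ r v ≤ N := by simp [hS]
    refine (hle (fun v => Ψ (r v)) S fun x hx => ?_).trans ?_
    · have h1 : r x < N := by
        by_contra h
        exact hx (hΨN _ (not_lt.1 h))
      exact ⟨(hmem x).2 h1.le, fun y hy => (hmem y).2 ((hadj x y hy).trans h1)⟩
    -- Edges within one rank carry no energy; the others are oriented upwards, each being counted
    -- once by `t x y` and once by `t y x`.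
    set t : V → V → ℝ := fun x y =>
      if G.Adj x y ∧ r y = r x + 1 then (Ψ (r x) - Ψ (r x + 1)) ^ 2 else 0 with ht
    have ht0 : ∀ x y, 0 ≤ t x y := fun x y => by
      simp only [ht]
      split_ifs
      exacts [sq_nonneg _, le_rfl]
    have h1 : G.dirichletForm S (fun v => Ψ (r v)) (fun v => Ψ (r v)) ≤
        ∑ x ∈ S, ∑ y ∈ S, (t x y + t y x) := by
      refine Finset.sum_le_sum fun x _ => Finset.sum_le_sum fun y _ => ?_
      split_ifs with h
      · have h2 := hadj x y h
        have h3 := hadj y x h.symm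
        rcases lt_trichotomy (r x) (r y) with h4 | h4 | h4
        · have h5 : r y = r x + 1 := by omega
          refine le_trans (le_of_eq ?_) (le_add_of_nonneg_right (ht0 y x))
          simp only [ht, if_pos (And.intro h h5), h5]
          ring
        · simpa [h4] using add_nonneg (ht0 x y) (ht0 y x)
        · have h5 : r x = r y + 1 := by omega
          refine le_trans (le_of_eq ?_) (le_add_of_nonneg_left (ht0 x y))
          simp only [ht, if_pos (And.intro h.symm h5), h5]
          ring
      · exact add_nonneg (ht0 x y) (ht0 y x)
    have h2 : ∑ x ∈ S, ∑ y ∈ S, (t x y + t y x) = 2 * ∑ x ∈ S, ∑ y ∈ S, t x y := by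
      simp only [Finset.sum_add_distrib]
      rw [Finset.sum_comm (f := fun x y => t y x), two_mul]
    have h3 : ∑ x ∈ S, ∑ y ∈ S, t x y ≤ (s N)⁻¹ := by
      have hmaps : ∀ q ∈ (S ×ˢ S).filter (fun q => G.Adj q.1 q.2 ∧ r q.2 = r q.1 + 1),
          r q.1 ∈ Finset.range N := by
        intro q hq
        simp only [Finset.mem_filter, Finset.mem_product, hmem] at hq
        rw [Finset.mem_range]
        omega
      rw [← Finset.sum_product' S S t]
      simp only [ht]
      rw [← Finset.sum_filter, ← Finset.sum_fiberwise_of_maps_to hmaps]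
      have h4 : (s N)⁻¹ = ∑ n ∈ Finset.range N, c n * ((c n)⁻¹ / s N) ^ 2 := by
        calc (s N)⁻¹ = s N / s N ^ 2 := by field_simp
          _ = _ := by
            nth_rw 1 [hs]
            rw [Finset.sum_div]
            refine Finset.sum_congr rfl fun n _ => ?_
            have := (hc n).ne'
            field_simp
      rw [h4]
      refine Finset.sum_le_sum fun n hn => ?_
      rw [Finset.sum_congr rfl (g := fun _ => ((c n)⁻¹ / s N) ^ 2), Finset.sum_const,
        nsmul_eq_mul]
      · refine mul_le_mul_of_nonneg_right (hcard n _ fun q hq => ?_) (sq_nonneg _)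
        simp only [Finset.mem_filter] at hq
        exact ⟨hq.1.2.1, hq.2, hq.2 ▸ hq.1.2.2⟩
      · intro q hq
        rw [(Finset.mem_filter.1 hq).2, hΨs n (Finset.mem_range.1 hn)]
    calc _ ≤ 2 * ∑ x ∈ S, ∑ y ∈ S, t x y := h1.trans_eq h2
      _ ≤ 2 * (s N)⁻¹ := by linarith
      _ = 2 / s N := (div_eq_mul_inv _ _).symm
  -- As `o` need not have rank zero, the test function equals `1` at `o` only in the limit.
  have hL : Tendsto (fun N => (1 - s (min (r o) N) / s N) ^ 2 * p) atTop (𝓝 p) := by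
    have h1 : Tendsto (fun N => s (min (r o) N) / s N) atTop (𝓝 0) := by
      refine (hdiv.const_div_atTop (s (r o))).congr' ?_
      filter_upwards [eventually_ge_atTop (r o)] with N hN
      rw [min_eq_left hN]
    simpa using ((h1.const_sub 1).pow 2).mul_const p
  have hp1 : p ≤ 0 := by
    refine le_of_tendsto_of_tendsto hL (hdiv.const_div_atTop 2) ?_
    filter_upwards [hdiv.eventually_gt_atTop 0] with N hN
    exact hbound N hN
  rwa [le_antisymm hp1 hp0] at hp

end SimpleGraph

/-! ### Growth of the greedy profile -/

section GreedyProfile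

variable {f : ℕ → ℝ≥0∞}

theorem greedyProfile_succ_of_le {n : ℕ} (h : (greedyProfile f n : ℝ≥0∞) + 1 ≤ f (n + 1)) :
    greedyProfile f (n + 1) = greedyProfile f n + 1 := by
  rw [greedyProfile, if_pos h]

theorem greedyProfile_succ_cases (f : ℕ → ℝ≥0∞) (n : ℕ) :
    greedyProfile f (n + 1) = greedyProfile f n + 1 ∨
      greedyProfile f (n + 1) = greedyProfile f n := by
  rw [greedyProfile]
  split_ifs <;> simp

theorem greedyProfile_mono (f : ℕ → ℝ≥0∞) : Monotone (greedyProfile f) :=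
  monotone_nat_of_le_succ fun n => by
    have := greedyProfile_succ_cases f n
    omega

theorem greedyProfile_le (hf : Monotone f) (n : ℕ) : (greedyProfile f n : ℝ≥0∞) ≤ f n := by
  induction n with
  | zero => simp [greedyProfile]
  | succ n ih =>
    rw [greedyProfile]
    split_ifs with h
    · exact_mod_cast h
    · exact ih.trans (hf n.le_succ)

/-- If there is still room above the profile at time `n` under the bound `f m`, then by monotonicity
there was room at every step from `m` to `n`, and each of them was an increase. -/
theorem sub_le_greedyProfile (hf : Monotone f) {m n : ℕ} (hmn : m ≤ n)
    (h : (greedyProfile f n : ℝ≥0∞) + 1 ≤ f m) : n - m ≤ greedyProfile f n := by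
  induction n, hmn using Nat.le_induction with
  | base => simp
  | succ n hmn ih =>
    have h1 : (greedyProfile f n : ℝ≥0∞) + 1 ≤ f m := by
      refine le_trans ?_ h
      gcongr
      exact greedyProfile_mono f n.le_succ
    have h2 := greedyProfile_succ_of_le (h1.trans (hf (hmn.trans n.le_succ)))
    have h3 := ih h1
    omega

/-- From time `m` on, the profile grows at every step until it reaches `k`. Hence the boxes exhaust
the wedge. -/
theorem le_greedyProfile_add (hf : Monotone f) {k m : ℕ} (h : (k : ℝ≥0∞) ≤ f m) :
    k ≤ greedyProfile f (m + k) := by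
  induction k with
  | zero => simp
  | succ k ih =>
    have h1 : k ≤ greedyProfile f (m + k) := ih (le_trans (by gcongr; simp) h)
    have h2 := greedyProfile_mono f (m + k).le_succ
    rcases h1.lt_or_eq with h3 | h3
    · exact h3.trans_le h2
    · refine (greedyProfile_succ_of_le (n := m + k) ?_ ▸ by omega :
        k + 1 ≤ greedyProfile f (m + k + 1))
      rw [← h3]
      exact (by exact_mod_cast h : (k : ℝ≥0∞) + 1 ≤ f m).trans (hf (by omega))

end GreedyProfile

/-! ### Exhaustion by boxes, counting exit edges, and recurrence -/

section Wedge

variable {d : ℕ} {f : Fin d → ℕ → ℝ≥0∞}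

theorem wedge_adj_cases {u v : wedgeVertices f} (h : (wedge f).Adj u v) :
    ∃ j, |u.1 j - v.1 j| = 1 ∧ ∀ k, k ≠ j → u.1 k = v.1 k := by
  have h' : ∑ j, |u.1 j - v.1 j| = 1 := h
  obtain ⟨j, -, hj⟩ : ∃ j ∈ Finset.univ, |u.1 j - v.1 j| ≠ 0 := by
    by_contra hne
    push Not at hne
    rw [Finset.sum_eq_zero hne] at h'
    omega
  have h1 := Finset.add_sum_erase Finset.univ (fun j => |u.1 j - v.1 j|) (Finset.mem_univ j)
  have h2 : ∀ k ∈ Finset.univ.erase j, 0 ≤ |u.1 k - v.1 k| := fun _ _ => abs_nonneg _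
  have h3 := Finset.sum_nonneg h2
  have h4 : 0 < |u.1 j - v.1 j| := lt_of_le_of_ne (abs_nonneg _) hj.symm
  simp only [h'] at h1
  refine ⟨j, by omega, fun k hk => ?_⟩
  have h5 := (Finset.sum_eq_zero_iff_of_nonneg h2).1 (by omega) k
    (Finset.mem_erase.2 ⟨hk, Finset.mem_univ k⟩)
  rwa [abs_eq_zero, sub_eq_zero] at h5

/-- The box `{x : x_{d+1} ≤ n, xᵢ ≤ hᵢ(n)}`, where `hᵢ` is the greedy profile of `fᵢ`. -/
def wedgeBox (f : Fin d → ℕ → ℝ≥0∞) (n : ℕ) : Set (wedgeVertices f) :=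
  {x | x.1 (Fin.last d) ≤ n ∧ ∀ i : Fin d, x.1 i.castSucc ≤ greedyProfile (f i) n}

theorem wedgeBox_mono : Monotone (wedgeBox f) := fun m n hmn x hx =>
  ⟨hx.1.trans (by exact_mod_cast hmn), fun i => (hx.2 i).trans
    (by exact_mod_cast greedyProfile_mono (f i) hmn)⟩

theorem wedgeVertices_nonneg (x : wedgeVertices f) (j : Fin (d + 1)) : 0 ≤ x.1 j := by
  obtain ⟨x, n, hn, hx⟩ := x
  refine Fin.lastCases ?_ (fun i => ?_) j
  · simp [hn]
  · obtain ⟨k, hk, -⟩ := hx i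
    simp [hk]

theorem finite_wedgeBox (n : ℕ) : (wedgeBox f n).Finite := by
  refine Set.Finite.of_finite_image ((Set.finite_Icc (0 : Fin (d + 1) → ℤ)
    (Fin.lastCases (n : ℤ) fun i => (greedyProfile (f i) n : ℤ))).subset ?_)
    Subtype.val_injective.injOn
  rintro _ ⟨x, hx, rfl⟩
  refine ⟨fun j => wedgeVertices_nonneg x j, fun j => ?_⟩
  refine Fin.lastCases ?_ (fun i => ?_) j
  · simpa using hx.1
  · simpa using hx.2 i

theorem exists_mem_wedgeBox (hf : ∀ i, Monotone (f i)) (x : wedgeVertices f) :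
    ∃ n, x ∈ wedgeBox f n := by
  obtain ⟨x, m, hm, hx⟩ := x
  have hx' := hx
  choose k hk hkf using hx'
  refine ⟨m + ∑ i, k i, ?_, fun i => ?_⟩
  · simp only [hm]
    push_cast
    have : 0 ≤ ∑ i, (k i : ℤ) := Finset.sum_nonneg fun _ _ => Int.natCast_nonneg _
    omega
  · simp only [hk i]
    have h1 := le_greedyProfile_add (hf i) (hkf i)
    have h2 : k i ≤ ∑ i, k i := Finset.single_le_sum (fun _ _ => Nat.zero_le _) (Finset.mem_univ i)
    exact_mod_cast h1.trans (greedyProfile_mono (f i) (by omega))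

/-- Edges leaving a box increase one coordinate; if it is not the last one, the edge is close to
the top of the box. -/
theorem exists_of_adj_of_notMem_wedgeBox {u v : wedgeVertices f}
    (h : (wedge f).Adj u v) {n : ℕ} (hu : u ∈ wedgeBox f n) (hv : v ∉ wedgeBox f n) :
    ∃ j, v.1 j = u.1 j + 1 ∧ (∀ k, k ≠ j → v.1 k = u.1 k) ∧
      (j = Fin.last d ∧ u.1 j = n ∨
        ∃ i : Fin d, j = i.castSucc ∧ u.1 j = greedyProfile (f i) n ∧
          (greedyProfile (f i) n : ℝ≥0∞) + 1 ≤ f i (u.1 (Fin.last d)).toNat) := by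
  obtain ⟨j, hj, hne⟩ := wedge_adj_cases h
  have hj' : v.1 j = u.1 j + 1 ∨ v.1 j = u.1 j - 1 := by
    rcases (abs_eq zero_le_one).1 hj with h | h <;> omega
  have hup : v.1 j = u.1 j + 1 := by
    refine hj'.resolve_right fun hd => hv ?_
    have hle : ∀ k, v.1 k ≤ u.1 k := fun k => by
      by_cases hk : k = j
      · subst hk; omega
      · exact (hne k hk).ge
    exact ⟨(hle _).trans hu.1, fun i => (hle _).trans (hu.2 i)⟩
  refine ⟨j, hup, fun k hk => (hne k hk).symm, ?_⟩
  induction j using Fin.lastCases with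
  | last =>
    refine Or.inl ⟨rfl, le_antisymm hu.1 ?_⟩
    by_contra hlt
    refine hv ⟨by omega, fun i => ?_⟩
    rw [← hne _ (Fin.castSucc_lt_last i).ne]
    exact hu.2 i
  | cast i =>
    have hlast : v.1 (Fin.last d) = u.1 (Fin.last d) := (hne _ (Fin.castSucc_lt_last i).ne').symm
    have heq : u.1 i.castSucc = greedyProfile (f i) n := by
      refine le_antisymm (hu.2 i) ?_
      by_contra hlt
      refine hv ⟨hlast.trans_le hu.1, fun l => ?_⟩
      by_cases hl : l = i
      · subst hl; omega
      · rw [← hne _ (fun h => hl (Fin.castSucc_injective d h))]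
        exact hu.2 l
    refine Or.inr ⟨i, rfl, heq, ?_⟩
    obtain ⟨m, hm, hx⟩ := v.2
    obtain ⟨k, hk, hkf⟩ := hx i
    rw [← hlast, hm, Int.toNat_natCast]
    have : k = greedyProfile (f i) n + 1 := by omega
    rw [this] at hkf
    exact_mod_cast hkf

/-- An edge can leave through side `i` only if `f i` leaves room for one more, and then the greedy
profile takes it at the next step. -/
theorem mem_wedgeBox_succ_of_adj (hf : ∀ i, Monotone (f i)) {u v : wedgeVertices f}
    (h : (wedge f).Adj u v) {n : ℕ} (hu : u ∈ wedgeBox f n) : v ∈ wedgeBox f (n + 1) := by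
  by_cases hv : v ∈ wedgeBox f n
  · exact wedgeBox_mono n.le_succ hv
  obtain ⟨j, hj, hne, hcase⟩ := exists_of_adj_of_notMem_wedgeBox h hu hv
  have hu' := wedgeBox_mono n.le_succ hu
  rcases hcase with ⟨rfl, hn⟩ | ⟨i, rfl, hi, hle⟩
  · refine ⟨by rw [hj, hn]; push_cast; rfl, fun i => ?_⟩
    rw [hne _ (Fin.castSucc_lt_last i).ne]
    exact hu'.2 i
  · refine ⟨?_, fun l => ?_⟩
    · rw [hne _ (Fin.castSucc_lt_last i).ne']
      exact hu'.1
    · by_cases hl : l = i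
      · subst hl
        have h1 := greedyProfile_succ_of_le (hle.trans (hf l (by
          have := hu.1
          omega : (u.1 (Fin.last d)).toNat ≤ n + 1)))
        rw [hj, hi, h1]
        push_cast
        rfl
      · rw [hne _ (fun h => hl (Fin.castSucc_injective d h))]
        exact hu'.2 l

theorem card_le_of_adj_of_notMem_wedgeBox (hf : ∀ i, Monotone (f i)) (n : ℕ)
    (T : Finset (wedgeVertices f × wedgeVertices f))
    (hT : ∀ p ∈ T, (wedge f).Adj p.1 p.2 ∧ p.1 ∈ wedgeBox f n ∧ p.2 ∉ wedgeBox f n) :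
    T.card ≤ (d + 1) * ∏ i, (greedyProfile (f i) n + 1) := by
  classical
  have hex : ∀ p : wedgeVertices f × wedgeVertices f, ∃ j, p ∈ T → p.2.1 j = p.1.1 j + 1 ∧
      (∀ k, k ≠ j → p.2.1 k = p.1.1 k) ∧
      (j = Fin.last d ∧ p.1.1 j = n ∨
        ∃ i : Fin d, j = i.castSucc ∧ p.1.1 j = greedyProfile (f i) n ∧
          (greedyProfile (f i) n : ℝ≥0∞) + 1 ≤ f i (p.1.1 (Fin.last d)).toNat) := by
    intro p
    by_cases hp : p ∈ T
    · obtain ⟨h1, h2, h3⟩ := hT p hp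
      obtain ⟨j, hj⟩ := exists_of_adj_of_notMem_wedgeBox h1 h2 h3
      exact ⟨j, fun _ => hj⟩
    · exact ⟨0, fun h => absurd h hp⟩
  choose J hJ using hex
  -- On an exit through side `i`, coordinate `i` is known to be `hᵢ(n)`, so its slot is free to
  -- record the depth below the top, which `sub_le_greedyProfile` keeps at most `hᵢ(n)`. For an exit
  -- through the top the height is known and no slot is altered. With the direction `J p`, this
  -- determines the edge.
  set code : wedgeVertices f × wedgeVertices f → Fin d → ℕ := fun p i =>
    if i.castSucc = J p then n - (p.1.1 (Fin.last d)).toNat else (p.1.1 i.castSucc).toNat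
    with hcode
  have hcard : (Finset.univ (α := Fin (d + 1)) ×ˢ
      Fintype.piFinset fun i => Finset.range (greedyProfile (f i) n + 1)).card =
        (d + 1) * ∏ i, (greedyProfile (f i) n + 1) := by
    simp
  rw [← hcard]
  refine Finset.card_le_card_of_injOn (fun p => (J p, code p)) ?_ ?_
  · intro p hp
    have hp : p ∈ T := hp
    simp only [Finset.coe_product, Set.mem_prod, Finset.coe_univ, Set.mem_univ, true_and,
      Finset.mem_coe, Fintype.mem_piFinset, Finset.mem_range]
    intro i
    have hbox := (hT p hp).2.1
    simp only [hcode]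
    split_ifs with h
    · rcases (hJ p hp).2.2 with h1 | ⟨l, h1, -, h2⟩
      · exact absurd (h.trans h1.1) (Fin.castSucc_lt_last i).ne
      · obtain rfl : i = l := Fin.castSucc_injective d (h.trans h1)
        have := sub_le_greedyProfile (hf i) (by have := hbox.1; omega) h2
        omega
    · have := hbox.2 i
      omega
  · intro p hp q hq hpq
    have hp : p ∈ T := hp
    have hq : q ∈ T := hq
    simp only [Prod.mk.injEq] at hpq
    obtain ⟨hjj, hcc⟩ := hpq
    obtain ⟨hp1, hp2, hp3⟩ := hJ p hp
    obtain ⟨hq1, hq2, hq3⟩ := hJ q hq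
    have hcast : ∀ i : Fin d, i.castSucc ≠ J p → p.1.1 i.castSucc = q.1.1 i.castSucc := by
      intro i hi
      have := congrFun hcc i
      simp only [hcode, ← hjj, if_neg hi] at this
      have h1 := wedgeVertices_nonneg p.1 i.castSucc
      have h2 := wedgeVertices_nonneg q.1 i.castSucc
      omega
    have h1 : p.1.1 = q.1.1 := by
      rw [← hjj] at hq3
      rcases hp3 with ⟨h3, h4⟩ | ⟨i, h3, h4, -⟩
      · rcases hq3 with ⟨-, h5⟩ | ⟨l, h5, -⟩
        · funext k
          induction k using Fin.lastCases with
          | last => rw [← h3, h4, h5]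
          | cast i => exact hcast i (h3 ▸ (Fin.castSucc_lt_last i).ne)
        · exact absurd (h5.symm.trans h3) (Fin.castSucc_lt_last l).ne
      · rcases hq3 with ⟨h5, -⟩ | ⟨l, h5, h6, -⟩
        · exact absurd (h3.symm.trans h5) (Fin.castSucc_lt_last i).ne
        · obtain rfl : i = l := Fin.castSucc_injective d (h3.symm.trans h5)
          funext k
          induction k using Fin.lastCases with
          | last =>
            have := congrFun hcc i
            simp only [hcode, ← hjj, if_pos h3.symm] at this
            have h7 := (hT p hp).2.1.1
            have h8 := (hT q hq).2.1.1
            have h9 := wedgeVertices_nonneg p.1 (Fin.last d)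
            have h10 := wedgeVertices_nonneg q.1 (Fin.last d)
            omega
          | cast l =>
            by_cases hl : l.castSucc = J p
            · rw [hl, h4, h6]
            · exact hcast l hl
    refine Prod.ext (Subtype.ext h1) (Subtype.ext (funext fun k => ?_))
    by_cases hk : k = J p
    · rw [hk, hp1, h1, hjj, hq1]
    · rw [hp2 k hk, h1, hq2 k (hjj ▸ hk)]

open Filter in
theorem wedge_isRecurrent (hf : ∀ i, Monotone (f i))
    (h : Tendsto (fun N => ∑ n ∈ Finset.range N, (∏ i, ((greedyProfile (f i) n : ℝ) + 1))⁻¹)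
      atTop atTop) : (wedge f).IsRecurrent := by
  classical
  have hex := exists_mem_wedgeBox hf
  set r : wedgeVertices f → ℕ := fun x => Nat.find (hex x) with hr
  have hle : ∀ x n, r x ≤ n ↔ x ∈ wedgeBox f n := fun x n =>
    ⟨fun h => wedgeBox_mono h (Nat.find_spec (hex x)), fun h => Nat.find_min' _ h⟩
  refine (wedge f).isRecurrent_of_tendsto_sum_inv (wedge_neighborFinset_nonempty hf) (r := r)
    (c := fun n => (d + 1) * ∏ i, ((greedyProfile (f i) n : ℝ) + 1)) (fun n => ?_)
    (fun u v huv => ?_) (fun n => ?_) (fun n T hT => ?_) ?_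
  · simp only [hle]
    exact finite_wedgeBox n
  · exact (hle _ _).2 (mem_wedgeBox_succ_of_adj hf huv ((hle _ _).1 le_rfl))
  · positivity
  · have := card_le_of_adj_of_notMem_wedgeBox hf n T fun p hp => by
      obtain ⟨h1, h2, h3⟩ := hT p hp
      refine ⟨h1, (hle _ _).1 h2.le, fun h4 => ?_⟩
      have := (hle _ _).2 h4
      omega
    exact_mod_cast this
  · refine (h.const_mul_atTop (r := ((d : ℝ) + 1)⁻¹) (by positivity)).congr fun N => ?_
    simp only [Finset.mul_sum, mul_inv]

end Wedge

/-! ### Means over boxes that grow by one -/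

section BoxAverage

variable {ι : Type*} [Fintype ι] [DecidableEq ι]

/-- The mean of `φ` over the box `∏ᵢ {0, …, bᵢ}`. -/
noncomputable def boxMean (b : ι → ℕ) (φ : (ι → ℕ) → ℝ) : ℝ :=
  (∏ i, ((b i : ℝ) + 1))⁻¹ * ∑ k ∈ Fintype.piFinset fun i => Finset.range (b i + 1), φ k

theorem sq_inv_mul_sum_le (b : ι → ℕ) (φ : (ι → ℕ) → ℝ) :
    ((∏ i, ((b i : ℝ) + 1))⁻¹ *
      ∑ k ∈ Fintype.piFinset fun i => Finset.range (b i + 1), φ k) ^ 2 ≤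
    (∏ i, ((b i : ℝ) + 1))⁻¹ *
      ∑ k ∈ Fintype.piFinset fun i => Finset.range (b i + 1), φ k ^ 2 := by
  have hpos : 0 < ∏ i, ((b i : ℝ) + 1) := Finset.prod_pos fun i _ => by positivity
  have h := sq_sum_le_card_mul_sum_sq
    (s := Fintype.piFinset fun i => Finset.range (b i + 1)) (f := φ)
  have hc : ((Fintype.piFinset fun i => Finset.range (b i + 1)).card : ℝ) =
      ∏ i, ((b i : ℝ) + 1) := by simp
  rw [hc] at h
  calc _ = (∏ i, ((b i : ℝ) + 1))⁻¹ ^ 2 *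
        (∑ k ∈ Fintype.piFinset fun i => Finset.range (b i + 1), φ k) ^ 2 := mul_pow _ _ _
    _ ≤ (∏ i, ((b i : ℝ) + 1))⁻¹ ^ 2 * _ := mul_le_mul_of_nonneg_left h (sq_nonneg _)
    _ = _ := by field_simp

theorem boxMean_sub_sq_le (b : ι → ℕ) (φ ψ : (ι → ℕ) → ℝ) :
    (boxMean b φ - boxMean b ψ) ^ 2 ≤ (∏ i, ((b i : ℝ) + 1))⁻¹ *
      ∑ k ∈ Fintype.piFinset fun i => Finset.range (b i + 1), (φ k - ψ k) ^ 2 := by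
  refine le_trans (le_of_eq ?_) (sq_inv_mul_sum_le b fun k => φ k - ψ k)
  rw [Finset.sum_sub_distrib, mul_sub, boxMean, boxMean]

/-- Summation by parts in coordinate `i`: on the larger box write `b i + 1 = (b i + 1 - k i) + k i`.
The first weight vanishes on the new face; the second vanishes at `k i = 0` and is shifted down by
one. -/
theorem sum_box_update_succ (b : ι → ℕ) (i : ι) (φ : (ι → ℕ) → ℝ) :
    ((b i : ℝ) + 1) * ∑ k ∈ Fintype.piFinset fun j =>
        Finset.range (Function.update b i (b i + 1) j + 1), φ k -
      ((b i : ℝ) + 2) * ∑ k ∈ Fintype.piFinset fun j => Finset.range (b j + 1), φ k =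
    ∑ k ∈ Fintype.piFinset fun j => Finset.range (b j + 1),
      ((k i : ℝ) + 1) * (φ (Function.update k i (k i + 1)) - φ k) := by
  set s := Fintype.piFinset fun j => Finset.range (b j + 1) with hs
  set t := Fintype.piFinset fun j => Finset.range (Function.update b i (b i + 1) j + 1) with ht
  have hms : ∀ k, k ∈ s ↔ ∀ j, k j < b j + 1 := by simp [hs]
  have hmt : ∀ k, k ∈ t ↔ k i < b i + 2 ∧ ∀ j, j ≠ i → k j < b j + 1 := by
    intro k
    simp only [ht, Fintype.mem_piFinset, Finset.mem_range]
    refine ⟨fun h => ⟨by simpa [Nat.lt_succ_iff] using h i, fun j hj => by simpa [hj] using h j⟩, fun h j => ?_⟩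
    by_cases hj : j = i
    · subst hj; simpa [Nat.lt_succ_iff] using h.1
    · simpa [hj] using h.2 j hj
  have h1 : ∑ k ∈ s, ((k i : ℝ) + 1) * φ (Function.update k i (k i + 1)) =
      ∑ k ∈ t, (k i : ℝ) * φ k := by
    refine Finset.sum_of_injOn (fun k => Function.update k i (k i + 1)) ?_ ?_ ?_ ?_
    · intro k _ l _ hkl
      funext j
      have := congrFun hkl j
      by_cases hj : j = i
      · subst hj; simpa using this
      · simpa [hj] using this
    · intro k hk
      have hk := (hms k).1 hk
      refine (hmt _).2 ⟨by simpa using hk i, fun j hj => by simpa [hj] using hk j⟩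
    · intro k hk hni
      have hk := (hmt k).1 hk
      suffices h0 : k i = 0 by simp [h0]
      by_contra h0
      refine hni ⟨Function.update k i (k i - 1), (hms _).2 fun j => ?_, ?_⟩
      · by_cases hj : j = i
        · subst hj; simp only [Function.update_self]; omega
        · simpa [hj] using hk.2 j hj
      · simp only [Function.update_self, Function.update_idem]
        rw [Nat.sub_add_cancel (by omega), Function.update_eq_self]
    · intro k _
      simp
  have h2 : ∑ k ∈ s, ((b i : ℝ) + 1 - k i) * φ k = ∑ k ∈ t, ((b i : ℝ) + 1 - k i) * φ k := by
    refine Finset.sum_subset (fun k hk => ?_) fun k hk hk' => ?_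
    · have hk := (hms k).1 hk
      exact (hmt k).2 ⟨by have := hk i; omega, fun j _ => hk j⟩
    · have hk := (hmt k).1 hk
      have : k i = b i + 1 := by
        by_contra hne
        refine hk' ((hms k).2 fun j => ?_)
        by_cases hj : j = i
        · subst hj; omega
        · exact hk.2 j hj
      rw [this]
      push_cast
      ring
  have h3 : ((b i : ℝ) + 1) * ∑ k ∈ t, φ k =
      ∑ k ∈ t, ((b i : ℝ) + 1 - k i) * φ k + ∑ k ∈ t, (k i : ℝ) * φ k := by
    rw [← Finset.sum_add_distrib, Finset.mul_sum]
    exact Finset.sum_congr rfl fun k _ => by ring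
  rw [h3, ← h1, ← h2, Finset.mul_sum, ← Finset.sum_add_distrib, ← Finset.sum_sub_distrib]
  exact Finset.sum_congr rfl fun k _ => by ring

/-- The change of mean is the old box's mean of the increments in direction `i`, weighted by `(k i +
1) / (b i + 2) ≤ 1`; then Cauchy-Schwarz. -/
theorem boxMean_update_succ_sub_sq_le (b : ι → ℕ) (i : ι) (φ : (ι → ℕ) → ℝ) :
    (boxMean (Function.update b i (b i + 1)) φ - boxMean b φ) ^ 2 ≤
      (∏ j, ((b j : ℝ) + 1))⁻¹ * ∑ k ∈ Fintype.piFinset fun j => Finset.range (b j + 1),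
        (φ (Function.update k i (k i + 1)) - φ k) ^ 2 := by
  have hpos : 0 < ∏ j, ((b j : ℝ) + 1) := Finset.prod_pos fun i _ => by positivity
  have hp : ∏ j, ((Function.update b i (b i + 1) j : ℝ) + 1) =
      (∏ j, ((b j : ℝ) + 1)) * ((b i : ℝ) + 2) / ((b i : ℝ) + 1) := by
    rw [eq_div_iff (by positivity), ← Finset.mul_prod_erase _ _ (Finset.mem_univ i),
      ← Finset.mul_prod_erase _ (fun j => (b j : ℝ) + 1) (Finset.mem_univ i),
      Finset.prod_congr rfl (g := fun j => (b j : ℝ) + 1) fun j hj => by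
        rw [Function.update_of_ne (Finset.ne_of_mem_erase hj)], Function.update_self]
    push_cast
    ring
  have heq : boxMean (Function.update b i (b i + 1)) φ - boxMean b φ =
      (∏ j, ((b j : ℝ) + 1))⁻¹ * ∑ k ∈ Fintype.piFinset fun j => Finset.range (b j + 1),
        ((k i : ℝ) + 1) / (b i + 2) * (φ (Function.update k i (k i + 1)) - φ k) := by
    have h := sum_box_update_succ b i φ
    have h2 : (b i : ℝ) + 2 ≠ 0 := by positivity
    have h1 : (b i : ℝ) + 1 ≠ 0 := by positivity
    simp only [div_mul_eq_mul_div]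
    rw [← Finset.sum_div, ← h, boxMean, boxMean, hp]
    have := hpos.ne'
    field_simp
  rw [heq]
  refine (sq_inv_mul_sum_le _ _).trans ?_
  refine mul_le_mul_of_nonneg_left (Finset.sum_le_sum fun k hk => ?_) (inv_nonneg.2 hpos.le)
  rw [mul_pow]
  refine mul_le_of_le_one_left (sq_nonneg _) (pow_le_one₀ (by positivity) ?_)
  rw [div_le_one (by positivity)]
  have h1 : k i < b i + 1 := by simpa using Fintype.mem_piFinset.1 hk i
  have h2 : (k i : ℝ) + 1 ≤ b i + 1 := by exact_mod_cast h1
  linarith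

/-- Enlarging some sides of a box by one changes the mean by a controlled amount. -/
theorem abs_boxMean_sub_le {b c : ι → ℕ} (hbc : ∀ i, c i = b i + 1 ∨ c i = b i)
    (φ : (ι → ℕ) → ℝ) {K : ℝ} (hK : 0 ≤ K)
    (hstep : ∀ (b' : ι → ℕ) (i : ι), b ≤ b' → Function.update b' i (b' i + 1) ≤ c →
      |boxMean (Function.update b' i (b' i + 1)) φ - boxMean b' φ| ≤ K) :
    |boxMean c φ - boxMean b φ| ≤ Fintype.card ι * K := by
  have hle : ∀ i, b i ≤ c i := fun i => by have := hbc i; omega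
  -- The sides are enlarged one at a time; `s` collects those already done.
  have key : ∀ s : Finset ι, |boxMean (s.piecewise c b) φ - boxMean b φ| ≤ s.card * K := by
    intro s
    induction s using Finset.induction_on with
    | empty => simp
    | insert i s hi ih =>
      rw [Finset.piecewise_insert, Finset.card_insert_of_notMem hi]
      set b' := s.piecewise c b with hb'
      have hb'i : b' i = b i := by simp [hb', hi]
      have hbb' : b ≤ b' := Finset.le_piecewise_of_le_of_le _ hle le_rfl
      have hb'c : b' ≤ c := Finset.piecewise_le_of_le_of_le _ le_rfl hle
      rcases hbc i with h | h
      · have h1 := hstep b' i hbb' (by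
          rw [hb'i, ← h]
          exact update_le_iff.2 ⟨le_rfl, fun j _ => hb'c j⟩)
        rw [hb'i, ← h] at h1
        have h2 := abs_sub_le (boxMean (Function.update b' i (c i)) φ) (boxMean b' φ)
          (boxMean b φ)
        push_cast
        linarith
      · rw [h, ← hb'i, Function.update_eq_self]
        push_cast
        linarith
  simpa using key Finset.univ

end BoxAverage

/-! ### Energy lower bound and transience -/

section Transience

variable {d : ℕ} {f : Fin d → ℕ → ℝ≥0∞}

open scoped Classical in
/-- The vertex `(k₁, …, k_d, n)` of the wedge, or the origin if that point is not in the wedge. -/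
noncomputable def wedgePoint (f : Fin d → ℕ → ℝ≥0∞) (n : ℕ) (k : Fin d → ℕ) : wedgeVertices f :=
  if h : ∀ i, (k i : ℝ≥0∞) ≤ f i n then
    ⟨Fin.snoc (α := fun _ => ℤ) (fun i => (k i : ℤ)) n,
      n, by simp, fun i => ⟨k i, by simp, h i⟩⟩
  else ⟨0, 0, by simp, fun i => ⟨0, by simp, by simp⟩⟩

theorem wedgePoint_val {n : ℕ} {k : Fin d → ℕ} (h : ∀ i, (k i : ℝ≥0∞) ≤ f i n) :
    (wedgePoint f n k).1 = Fin.snoc (α := fun _ => ℤ) (fun i => (k i : ℤ)) n := by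
  rw [wedgePoint, dif_pos h]

theorem wedgePoint_last {n : ℕ} {k : Fin d → ℕ} (h : ∀ i, (k i : ℝ≥0∞) ≤ f i n) :
    (wedgePoint f n k).1 (Fin.last d) = n := by simp [wedgePoint_val h]

theorem wedgePoint_castSucc {n : ℕ} {k : Fin d → ℕ} (h : ∀ i, (k i : ℝ≥0∞) ≤ f i n) (i : Fin d) :
    (wedgePoint f n k).1 i.castSucc = k i := by simp [wedgePoint_val h]

theorem wedge_adj_wedgePoint_succ (hf : ∀ i, Monotone (f i)) {n : ℕ} {k : Fin d → ℕ}
    (h : ∀ i, (k i : ℝ≥0∞) ≤ f i n) :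
    (wedge f).Adj (wedgePoint f (n + 1) k) (wedgePoint f n k) := by
  have h' : ∀ i, (k i : ℝ≥0∞) ≤ f i (n + 1) := fun i => (h i).trans (hf i n.le_succ)
  change ∑ j, |_ - _| = (1 : ℤ)
  simp [Fin.sum_univ_castSucc, wedgePoint_last h, wedgePoint_last h', wedgePoint_castSucc h,
    wedgePoint_castSucc h']

theorem wedge_adj_wedgePoint_update {n : ℕ} {k : Fin d → ℕ} {i : Fin d}
    (h : ∀ j, (Function.update k i (k i + 1) j : ℝ≥0∞) ≤ f j n) :
    (wedge f).Adj (wedgePoint f n k) (wedgePoint f n (Function.update k i (k i + 1))) := by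
  have h' : ∀ j, (k j : ℝ≥0∞) ≤ f j n := fun j => by
    refine le_trans ?_ (h j)
    by_cases hj : j = i
    · subst hj; simp
    · simp [hj]
  change ∑ j, |_ - _| = (1 : ℤ)
  rw [Fin.sum_univ_castSucc, Finset.sum_eq_single i]
  · simp [wedgePoint_last h, wedgePoint_last h', wedgePoint_castSucc h, wedgePoint_castSucc h']
  · intro j _ hj
    simp [wedgePoint_castSucc h, wedgePoint_castSucc h', hj]
  · simp

/-- A discrete Hardy type inequality: finitely supported functions on the wedge are controlled at
the origin by their energy. -/
theorem sq_wedgePoint_zero_le (hf : ∀ i, Monotone (f i)) {F : wedgeVertices f → ℝ}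
    (hF : {v | F v ≠ 0}.Finite) {ε : ℝ}
    (hε : ∀ T : Finset (wedgeVertices f),
      ∑ x ∈ T, ∑ y ∈ (wedge f).neighborFinset x, (F x - F y) ^ 2 ≤ ε) {σ : ℝ}
    (hσ : ∀ N, ∑ n ∈ Finset.range N, (∏ i, ((greedyProfile (f i) n : ℝ) + 1))⁻¹ ≤ σ) :
    F (wedgePoint f 0 0) ^ 2 ≤ σ * ((d + 1) ^ 2 * ε) := by
  classical
  set h : ℕ → Fin d → ℕ := fun n i => greedyProfile (f i) n with hh
  set a : ℕ → ℝ := fun n => (∏ i, ((h n i : ℝ) + 1))⁻¹ with ha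
  have ha0 : ∀ n, 0 ≤ a n := fun n => by simp only [ha]; positivity
  set box : (Fin d → ℕ) → Finset (Fin d → ℕ) :=
    fun b => Fintype.piFinset fun i => Finset.range (b i + 1) with hbox
  have hmem : ∀ b k, k ∈ box b ↔ k ≤ b := fun b k => by
    simp [hbox, Pi.le_def]
  set e : wedgeVertices f → ℝ := fun x =>
    ∑ y ∈ (wedge f).neighborFinset x, (F x - F y) ^ 2 with he
  have he0 : ∀ x, 0 ≤ e x := fun x => Finset.sum_nonneg fun _ _ => sq_nonneg _
  have hadj : ∀ x y, (wedge f).Adj x y → (F x - F y) ^ 2 ≤ e x := fun x y hxy =>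
    Finset.single_le_sum (f := fun y => (F x - F y) ^ 2) (fun _ _ => sq_nonneg _)
      (by simpa using hxy)
  have hvalid : ∀ n k, k ≤ h n → ∀ i, (k i : ℝ≥0∞) ≤ f i n := fun n k hk i =>
    le_trans (by exact_mod_cast hk i) (greedyProfile_le (hf i) n)
  have hmono : ∀ n, h n ≤ h (n + 1) := fun n i => greedyProfile_mono (f i) n.le_succ
  set φ : ℕ → (Fin d → ℕ) → ℝ := fun n k => F (wedgePoint f n k) with hφ
  set Q : ℕ → ℝ := fun n => ∑ k ∈ box (h n), e (wedgePoint f n k) with hQ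
  have hQ0 : ∀ n, 0 ≤ Q n := fun n => Finset.sum_nonneg fun _ _ => he0 _
  set A : ℕ → ℝ := fun n => boxMean (h n) (φ n) with hA
  -- Raise the slice first, keeping its shape, along vertical edges; then widen it in `hside` along
  -- horizontal edges of level `n + 1`. Both costs are charged to `Q (n + 1)`.
  have hup : ∀ n, (boxMean (h n) (φ (n + 1)) - boxMean (h n) (φ n)) ^ 2 ≤ a n * Q (n + 1) := by
    intro n
    refine (boxMean_sub_sq_le _ _ _).trans (mul_le_mul_of_nonneg_left ?_ (ha0 n))
    refine (Finset.sum_le_sum fun k hk => hadj _ _ (wedge_adj_wedgePoint_succ hf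
      (hvalid n k ((hmem _ _).1 hk)))).trans ?_
    exact Finset.sum_le_sum_of_subset_of_nonneg
      (fun k hk => (hmem _ _).2 (((hmem _ _).1 hk).trans (hmono n))) fun _ _ _ => he0 _
  have hside : ∀ n, |boxMean (h (n + 1)) (φ (n + 1)) - boxMean (h n) (φ (n + 1))| ≤
      d * √(a n * Q (n + 1)) := by
    intro n
    have := abs_boxMean_sub_le (b := h n) (c := h (n + 1))
      (fun i => greedyProfile_succ_cases (f i) n) (φ (n + 1)) (Real.sqrt_nonneg (a n * Q (n + 1)))
      fun b i hb hc => Real.abs_le_sqrt ?_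
    · simpa using this
    refine (boxMean_update_succ_sub_sq_le b i (φ (n + 1))).trans (mul_le_mul ?_ ?_
      (Finset.sum_nonneg fun _ _ => sq_nonneg _) (ha0 n))
    · refine inv_anti₀ (Finset.prod_pos fun i _ => by positivity)
        (Finset.prod_le_prod (fun i _ => by positivity) fun j _ => ?_)
      have := hb j
      gcongr
    · have hbc : ∀ k ∈ box b, Function.update k i (k i + 1) ≤ h (n + 1) := by
        intro k hk
        have hk := (hmem _ _).1 hk
        refine le_trans (fun j => ?_) hc
        by_cases hj : j = i
        · subst hj; simpa using hk j
        · simpa [hj] using hk j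
      refine (Finset.sum_le_sum fun k hk => ?_).trans
        (Finset.sum_le_sum_of_subset_of_nonneg (t := box (h (n + 1)))
          (f := fun k => e (wedgePoint f (n + 1) k)) (fun k hk => (hmem _ _).2 ?_)
          fun _ _ _ => he0 _)
      · rw [← neg_sub, neg_sq]
        exact hadj _ _ (wedge_adj_wedgePoint_update (hvalid (n + 1) _ (hbc k hk)))
      · exact le_trans (le_update_iff.2 ⟨by omega, fun _ _ => le_rfl⟩) (hbc k hk)
  have hD : ∀ n, (A n - A (n + 1)) ^ 2 ≤ a n * ((d + 1) ^ 2 * Q (n + 1)) := by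
    intro n
    have h1 := Real.abs_le_sqrt (hup n)
    have h2 := hside n
    have h3 : |A n - A (n + 1)| ≤ (d + 1) * √(a n * Q (n + 1)) := by
      rw [abs_sub_comm]
      have := abs_sub_le (A (n + 1)) (boxMean (h n) (φ (n + 1))) (A n)
      linarith
    rw [← sq_abs]
    refine (pow_le_pow_left₀ (abs_nonneg _) h3 2).trans_eq ?_
    rw [mul_pow, Real.sq_sqrt (mul_nonneg (ha0 n) (hQ0 _))]
    ring
  -- Slices at different heights are disjoint, so no vertex is charged twice.
  have hQsum : ∀ N, ∑ n ∈ Finset.range N, Q (n + 1) ≤ ε := by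
    intro N
    simp only [hQ]
    rw [Finset.sum_sigma', ← Finset.sum_image (s := (Finset.range N).sigma fun n => box (h (n + 1)))
      (g := fun q => wedgePoint f (q.1 + 1) q.2) (f := e)]
    · exact hε _
    · rintro ⟨n, k⟩ hn ⟨m, l⟩ hm heq
      simp only [Finset.coe_sigma, Set.mem_sigma_iff, Finset.mem_coe, hmem] at hn hm
      have hn' := hvalid _ _ hn.2
      have hm' := hvalid _ _ hm.2
      simp only at heq
      have h1 := wedgePoint_last hn'
      rw [heq, wedgePoint_last hm'] at h1
      obtain rfl : m = n := by omega
      have h2 : k = l := by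
        funext i
        have h2 := wedgePoint_castSucc hn' i
        rw [heq, wedgePoint_castSucc hm'] at h2
        exact_mod_cast h2.symm
      rw [h2]
  have hA0 : A 0 = F (wedgePoint f 0 0) := by
    have : box (h 0) = {0} := by
      ext k
      rw [hmem, Finset.mem_singleton]
      exact le_bot_iff
    simp only [hA, boxMean]
    rw [show (Fintype.piFinset fun i => Finset.range (h 0 i + 1)) = {0} from this,
      Finset.sum_singleton]
    simp [hh, greedyProfile, hφ]
  -- A slice above the finite support of `F` has mean zero.
  obtain ⟨N, hN⟩ : ∃ N, A N = 0 := by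
    obtain ⟨M, hM⟩ := (hF.image fun v => v.1 (Fin.last d)).bddAbove
    refine ⟨(M + 1).toNat, ?_⟩
    simp only [hA, boxMean]
    rw [Finset.sum_eq_zero, mul_zero]
    intro k hk
    by_contra hne
    have h1 := hM ⟨_, hne, rfl⟩
    simp only at h1
    rw [wedgePoint_last (hvalid _ _ ((hmem _ _).1 hk))] at h1
    omega
  have htel : ∑ n ∈ Finset.range N, (A n - A (n + 1)) = F (wedgePoint f 0 0) := by
    rw [Finset.sum_range_sub', hN, hA0, sub_zero]
  rw [← htel]
  refine (Finset.sum_sq_le_sum_mul_sum_of_sq_le_mul _ (fun n _ => ha0 n)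
    (fun n _ => mul_nonneg (by positivity) (hQ0 _)) fun n _ => hD n).trans ?_
  rw [← Finset.mul_sum]
  exact mul_le_mul (hσ N) (mul_le_mul_of_nonneg_left (hQsum N) (by positivity))
    (mul_nonneg (by positivity) (Finset.sum_nonneg fun n _ => hQ0 _)) (by simpa using hσ 0)

theorem not_wedge_isRecurrent (hf : ∀ i, Monotone (f i))
    (h : Summable fun n => (∏ i, ((greedyProfile (f i) n : ℝ) + 1))⁻¹) :
    ¬ (wedge f).IsRecurrent := by
  intro hrec
  have hG := wedge_neighborFinset_nonempty hf
  have h1 := ((wedge f).ae_return_iff hG _).1 (hrec (wedgePoint f 0 0))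
  set σ := ∑' n, (∏ i, ((greedyProfile (f i) n : ℝ) + 1))⁻¹ with hσ
  have hσ0 : 0 ≤ σ := tsum_nonneg fun n => by positivity
  -- Chosen so that the energy bound would read `1 ≤ σ / (σ + 1)`.
  set ε : ℝ := ((σ + 1) * (d + 1) ^ 2)⁻¹ with hε
  obtain ⟨F, hF, hF1, hT⟩ := (wedge f).exists_energy_le_of_tendsto_avoidProb hG h1
    (ε := ε) (by positivity)
  have h2 := sq_wedgePoint_zero_le hf hF hT (σ := σ)
    fun N => h.sum_le_tsum _ fun n _ => by positivity
  rw [hF1] at h2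
  have h3 : σ * ((d + 1) ^ 2 * ε) = σ / (σ + 1) := by
    rw [hε]
    field_simp
  rw [h3, le_div_iff₀ (by positivity)] at h2
  linarith

end Transience

theorem theorem1p1 (d : ℕ) (f : Fin d → ℕ → ℝ≥0∞) (hf : ∀ i, Monotone (f i)) :
    (wedge f).IsRecurrent ↔
      ∑' n : ℕ, ∏ i : Fin d, 1 / ((greedyProfile (f i) n : ℝ≥0∞) + 1) = ∞ := by
  have h1 : ∀ n, ∏ i : Fin d, 1 / ((greedyProfile (f i) n : ℝ≥0∞) + 1) =
      ENNReal.ofReal (∏ i, ((greedyProfile (f i) n : ℝ) + 1))⁻¹ := by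
    intro n
    rw [← Finset.prod_inv_distrib, ENNReal.ofReal_prod_of_nonneg fun i _ => by positivity]
    refine Finset.prod_congr rfl fun i _ => ?_
    rw [ENNReal.ofReal_inv_of_pos (by positivity), one_div,
      ENNReal.ofReal_add (by positivity) zero_le_one, ENNReal.ofReal_natCast, ENNReal.ofReal_one]
  have h0 : ∀ n, 0 ≤ (∏ i, ((greedyProfile (f i) n : ℝ) + 1))⁻¹ := fun n => by positivity
  simp only [h1]
  constructor
  · intro hrec
    by_contra hne
    refine not_wedge_isRecurrent hf ?_ hrec
    refine (ENNReal.summable_toReal hne).congr fun n => ?_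
    rw [ENNReal.toReal_ofReal (h0 n)]
  · intro hsum
    refine wedge_isRecurrent hf ((not_summable_iff_tendsto_nat_atTop_of_nonneg h0).1 fun hs => ?_)
    exact hs.tsum_ofReal_ne_top hsum
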